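/- Let $\mathcal{A}$ be a finite set with the discrete topology, endow $\mathcal{A}^{\mathbb{Z}}$ with the product topology, and let $\sigma$ be the left shift, $(\sigma x)(i)=x(i+1)$. Let $X\subseteq\mathcal{A}^{\mathbb{Z}}$ be a subshift, i.e. a closed set with $\sigma(X)=X$. Suppose that $(X,\sigma)$ is topologically transitive, i.e. for all nonempty open $U,V\subseteq X$ there is $n\in\mathbb{Z}$ with $\sigma^n U\cap V\neq\emptyset$. Let $P_X(n)$ be the number of words $\beta\in\mathcal{A}^{\{0,\dots,n-1\}}$ for which there is $x\in X$ with $x(i)=\beta(i)$ for all $0\le i<n$, and suppose that $X$ has subquadratic growth, i.e. $$\liminf_{n\to\infty}\frac{P_X(n)}{n^2}=0.$$ Let $\mathrm{Aut}(X)$ be the group of all homeomorphisms $X\to X$ that commute with $\sigma$, and let $H$ be its subgroup generated by $\sigma$ (which is central, hence normal). Then the quotient group $\mathrm{Aut}(X)/H$ is periodic, i.e. each of its elements has finite order. (In other words, for every $\varphi\in\mathrm{Aut}(X)$ there are integers $a,b$ with $b\neq 0$ and $\varphi^b=\sigma^a$.) -/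

import Mathlib

open SymbolicDynamics.FullShift Filter
open scoped ENNReal

namespace SubshiftAut

/-- The shift action of `ℤ` on a two-sided subshift `X`: `(n +ᵥ x) i = x (n + i)`.
In particular `1 +ᵥ x` is the left shift `σ x`. -/
instance instAddAction {A : Type*} [TopologicalSpace A] (X : Subshift A ℤ) :
    AddAction ℤ X.carrier where
  vadd n x := ⟨shift n x.1, X.mapsTo n x.2⟩
  zero_vadd x := Subtype.ext (shift_zero x.1)
  add_vadd m n x := Subtype.ext (by
    change shift (m + n) x.1 = shift m (shift n x.1)
    rw [add_comm, shift_add])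

theorem coe_vadd {A : Type*} [TopologicalSpace A] (X : Subshift A ℤ) (n : ℤ) (x : X.carrier) :
    ((n +ᵥ x : X.carrier) : ℤ → A) = shift n x.1 := rfl

/-- The left shift `σ : X → X`, `(σ x) i = x (i + 1)`, as a homeomorphism of `X`. -/
def sigma {A : Type*} [TopologicalSpace A] (X : Subshift A ℤ) : X.carrier ≃ₜ X.carrier where
  toFun x := (1 : ℤ) +ᵥ x
  invFun x := (-1 : ℤ) +ᵥ x
  left_inv x := neg_vadd_vadd 1 x
  right_inv x := vadd_neg_vadd 1 x
  continuous_toFun :=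
    Continuous.subtype_mk ((continuous_shift (1 : ℤ)).comp continuous_subtype_val) _
  continuous_invFun :=
    Continuous.subtype_mk ((continuous_shift (-1 : ℤ)).comp continuous_subtype_val) _

theorem sigma_apply {A : Type*} [TopologicalSpace A] (X : Subshift A ℤ) (x : X.carrier) (i : ℤ) :
    (sigma X x : ℤ → A) i = (x : ℤ → A) (i + 1) := by
  change x.1 (1 + i) = x.1 (i + 1)
  rw [add_comm]

/-- `Aut(X)`: the group of homeomorphisms of `X` that commute with the shift. -/
def Aut {A : Type*} [TopologicalSpace A] (X : Subshift A ℤ) :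
    Subgroup (X.carrier ≃ₜ X.carrier) where
  carrier := {φ | ∀ x, φ (sigma X x) = sigma X (φ x)}
  mul_mem' {φ ψ} hφ hψ x := by
    change φ (ψ (sigma X x)) = sigma X (φ (ψ x))
    rw [hψ x, hφ (ψ x)]
  one_mem' _ := rfl
  inv_mem' {φ} hφ x := by
    change φ.symm (sigma X x) = sigma X (φ.symm x)
    rw [Homeomorph.symm_apply_eq, hφ, Homeomorph.apply_symm_apply]

/-- The shift as an element of `Aut(X)`. -/
def sigmaAut {A : Type*} [TopologicalSpace A] (X : Subshift A ℤ) : Aut X :=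
  ⟨sigma X, fun _ => rfl⟩

/-- The subgroup `H` of `Aut(X)` generated by the shift. -/
def shiftSubgroup {A : Type*} [TopologicalSpace A] (X : Subshift A ℤ) : Subgroup (Aut X) :=
  Subgroup.closure {sigmaAut X}

theorem sigmaAut_comm {A : Type*} [TopologicalSpace A] (X : Subshift A ℤ) (φ : Aut X) :
    φ * sigmaAut X = sigmaAut X * φ :=
  Subtype.ext (Homeomorph.ext φ.2)

/-- `H` is central, hence normal, so that the quotient `Aut(X) / H` is a group. -/
instance shiftSubgroup_normal {A : Type*} [TopologicalSpace A] (X : Subshift A ℤ) :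
    (shiftSubgroup X).Normal := by
  have h : shiftSubgroup X ≤ Subgroup.center (Aut X) := by
    rw [shiftSubgroup, Subgroup.closure_le, Set.singleton_subset_iff]
    exact Subgroup.mem_center_iff.2 (sigmaAut_comm X)
  refine ⟨fun n hn g => ?_⟩
  rw [Subgroup.mem_center_iff.1 (h hn) g, mul_inv_cancel_right]
  exact hn

/-- The block complexity `P_X(n)`: the number of words `β` of length `n` whose cylinder set
`{x | x i = β i for 0 ≤ i < n}` meets `X`. -/
noncomputable def blockComplexity {A : Type*} [TopologicalSpace A] (X : Subshift A ℤ) (n : ℕ) :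
    ℕ :=
  Set.ncard {β : Fin n → A |
    ({x : ℤ → A | ∀ i : Fin n, x ((i : ℕ) : ℤ) = β i} ∩ X.carrier).Nonempty}

/-- Subquadratic growth: `liminf P_X(n) / n² = 0`, the lower limit being taken in `[0, ∞]`. -/
def SubquadraticGrowth {A : Type*} [TopologicalSpace A] (X : Subshift A ℤ) : Prop :=
  liminf (fun n : ℕ => (blockComplexity X n : ℝ≥0∞) / (n : ℝ≥0∞) ^ 2) atTop = 0

end SubshiftAut

/-! Stacking the rows `φ^j x` gives a planar configuration in which equality of long segments
spreads to neighbouring rows with bounded loss. If `P_X(n) < M²` with `n` much larger than `M`, two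
of the `M²` windows of length `n` attached to an `M × M` box agree, so every cell is the centre of a
large diamond with a period of size at most `M` (`locallyPeriodic_spacetime`).

Such local periods force a global one (`LocallyPeriodic.exists_period`). A period valid on a whole
row is global. Otherwise it has a first break. Breaks persist in nearby rows and are locally unique,
so local periods carry breaks to breaks; hence they are not flat, and any two around one break are
parallel (`FirstBreak.parallel`). The break therefore recurs along a line, and its period fills a
strip. Sweeping sideways, the direction never changes (`PeriodicOnLevels.succ`), and a common
multiple of the periods met is global.

Thus every `x` is fixed by some `σ^p φ^q` with `(p, q) ≠ 0`. Baire category and transitivity make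
`(p, q)` independent of `x`. If `q = 0`, then `X` is finite, and so is `Aut(X)`. -/

namespace LatticeConfiguration

/-! ### Local periods and first breaks -/

variable {A : Type*} {η : ℤ → ℤ → A} {r M : ℤ}

/-- A coincidence of two horizontal segments of `η` propagates to the neighbouring rows, losing at
most `r` cells on both sides at each step. -/
def Spreads (η : ℤ → ℤ → A) (r : ℤ) : Prop :=
  ∀ a b j e lo hi : ℤ, (∀ i, lo ≤ i → i ≤ hi → η (i + a) (j + b) = η i j) →
    ∀ i, lo + r * |e| ≤ i → i ≤ hi - r * |e| → η (i + a) (j + e + b) = η i (j + e)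

/-- The vector `(p, q)` is a period of `η` on the diamond of radius `R` around `(i, j)`. -/
def PeriodicNear (η : ℤ → ℤ → A) (r p q i j R : ℤ) : Prop :=
  ∀ k l, |k - i| + r * |l - j| ≤ R → η (k + p) (l + q) = η k l

/-- Every cell is the centre of a diamond of radius `R` with a nonzero period of size `≤ M`. -/
def LocallyPeriodic (η : ℤ → ℤ → A) (r M R : ℤ) : Prop :=
  ∀ i j, ∃ p q, (p ≠ 0 ∨ q ≠ 0) ∧ |p| ≤ M ∧ 0 ≤ q ∧ q ≤ M ∧ PeriodicNear η r p q i j R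

/-- The period `(a, b)` fails at `(i, j)`, but holds on the `L` cells to the left of it. -/
def FirstBreak (η : ℤ → ℤ → A) (a b L i j : ℤ) : Prop :=
  η (i + a) (j + b) ≠ η i j ∧ ∀ k, i - L ≤ k → k < i → η (k + a) (j + b) = η k j

theorem PeriodicNear.mono {p q i j R R' : ℤ} (h : PeriodicNear η r p q i j R) (hR : R' ≤ R) :
    PeriodicNear η r p q i j R' :=
  fun k l hkl => h k l (hkl.trans hR)

theorem PeriodicNear.of_row (hD : Spreads η r) {p q i j R : ℤ}
    (h : ∀ k, |k - i| ≤ R → η (k + p) (j + q) = η k j) : PeriodicNear η r p q i j R := by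
  intro k l hkl
  have := hD p q j (l - j) (i - R) (i + R)
    (fun m h1 h2 => h m (abs_le.2 ⟨by linarith, by linarith⟩)) k
  have h3 := neg_abs_le (k - i)
  have h4 := le_abs_self (k - i)
  simpa using this (by linarith) (by linarith)

theorem FirstBreak.mono {a b L L' i j : ℤ} (h : FirstBreak η a b L i j) (hL : L' ≤ L) :
    FirstBreak η a b L' i j :=
  ⟨h.1, fun k h1 h2 => h.2 k (by linarith) h2⟩

theorem FirstBreak.unique {a b L i i' j : ℤ} (h : FirstBreak η a b L i j)
    (h' : FirstBreak η a b L i' j) (hi : |i - i'| ≤ L) : i = i' := by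
  obtain ⟨h1, h2⟩ := abs_le.1 hi
  rcases lt_trichotomy i i' with hlt | heq | hgt
  · exact absurd (h'.2 i (by linarith) hlt) h.1
  · exact heq
  · exact absurd (h.2 i' (by linarith) hgt) h'.1

/-- If the new row had no failure near `i`, spreading back by `-e` would erase the break. The least
failure is a first break; its length drops by `r * |e|` for the displacement and as much again for
the loss at the left end. -/
theorem FirstBreak.exists_row (hD : Spreads η r) {a b L i j : ℤ} (h : FirstBreak η a b L i j)
    (e : ℤ) : ∃ i', |i' - i| ≤ r * |e| ∧ FirstBreak η a b (L - 2 * (r * |e|)) i' (j + e) := by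
  have hex : ∃ k, i - r * |e| ≤ k ∧ k ≤ i + r * |e| ∧ η (k + a) (j + e + b) ≠ η k (j + e) := by
    by_contra! hno
    apply h.1
    have := hD a b (j + e) (-e) _ _ (fun k h1 h2 => hno k h1 h2) i
    rw [abs_neg] at this
    simpa using this (by linarith) (by linarith)
  obtain ⟨k, ⟨hk1, hk2, hk3⟩, hmin⟩ := Int.exists_least_of_bdd
    (P := fun k => i - r * |e| ≤ k ∧ k ≤ i + r * |e| ∧ η (k + a) (j + e + b) ≠ η k (j + e))
    ⟨_, fun z hz => hz.1⟩ hex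
  refine ⟨k, abs_le.2 ⟨by linarith, by linarith⟩, hk3, fun m h1 h2 => ?_⟩
  by_cases hm : i - r * |e| ≤ m
  · by_contra hne
    have := hmin m ⟨hm, by linarith, hne⟩
    linarith
  · push Not at hm
    exact hD a b j e (i - L) (i - 1) (fun n h3 h4 => h.2 n h3 (by linarith)) m (by linarith)
      (by linarith)

theorem FirstBreak.translate {a b L i j p q : ℤ} (h : FirstBreak η a b L i j)
    (h1 : ∀ k, i - L ≤ k → k ≤ i → η (k + p) (j + q) = η k j)
    (h2 : ∀ k, i - L ≤ k → k ≤ i → η (k + a + p) (j + b + q) = η (k + a) (j + b))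
    (hL : 0 ≤ L) : FirstBreak η a b L (i + p) (j + q) := by
  refine ⟨?_, fun k h3 h4 => ?_⟩
  · rw [add_right_comm, add_right_comm j, h1 i (by linarith) le_rfl, h2 i (by linarith) le_rfl]
    exact h.1
  · have e1 := h1 (k - p) (by linarith) (by linarith)
    have e2 := h2 (k - p) (by linarith) (by linarith)
    have e3 := h.2 (k - p) (by linarith) (by linarith)
    rw [sub_add_cancel] at e1
    rw [add_right_comm, sub_add_cancel, add_right_comm] at e2
    rw [e1, e2, e3]

/-- The translate of a first break by a period holding on a large diamond around it. -/
theorem FirstBreak.translate_near {K a b L i j p q R i₀ j₀ : ℤ} (h : FirstBreak η a b L i j)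
    (hr : 0 ≤ r) (ha : |a| ≤ M) (hb : r * |b| ≤ K) (hL : 0 ≤ L)
    (hp : PeriodicNear η r p q i₀ j₀ R) (hR : L + |i - i₀| + r * |j - j₀| + M + K ≤ R) :
    FirstBreak η a b L (i + p) (j + q) := by
  have hM := (abs_nonneg a).trans ha
  have hK := (mul_nonneg hr (abs_nonneg b)).trans hb
  have hki : ∀ k, i - L ≤ k → k ≤ i → |k - i₀| ≤ L + |i - i₀| := by
    intro k h1 h2
    calc |k - i₀| = |(k - i) + (i - i₀)| := by ring_nf
      _ ≤ |k - i| + |i - i₀| := abs_add_le _ _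
      _ ≤ _ := by gcongr; exact abs_le.2 ⟨by linarith, by linarith⟩
  refine h.translate (fun k h1 h2 => hp k j ?_) (fun k h1 h2 => hp _ _ ?_) hL
  · linarith [hki k h1 h2]
  · have e1 : |k + a - i₀| ≤ |k - i₀| + |a| := by
      rw [add_sub_right_comm]; exact abs_add_le _ _
    have e2 : |j + b - j₀| ≤ |j - j₀| + |b| := by
      rw [add_sub_right_comm]; exact abs_add_le _ _
    have e3 := mul_le_mul_of_nonneg_left e2 hr
    linarith [hki k h1 h2]

/-- A period around a break cannot be flatter than the propagation speed allows. -/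
theorem FirstBreak.slope_le (hD : Spreads η r) (hr : 1 ≤ r) {a b i j p q : ℤ}
    (h : FirstBreak η a b (16 * (r * M)) i j) (ha : |a| ≤ M) (hb : |b| ≤ M) (hp : |p| ≤ M)
    (hq : |q| ≤ M) (hper : PeriodicNear η r p q i j (20 * (r * M))) : |p| ≤ r * |q| := by
  have hM := (abs_nonneg a).trans ha
  have hMK : M ≤ r * M := le_mul_of_one_le_left hM hr
  have hb' : r * |b| ≤ r * M := by gcongr
  have hq' : r * |q| ≤ r * M := by gcongr
  obtain ⟨i', hi', hf⟩ := h.exists_row hD q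
  have ht := h.translate_near (by linarith) ha hb' (by linarith) hper
    (by simp only [sub_self, abs_zero]; linarith)
  -- Both cells are first breaks of row `j + q`, so local uniqueness identifies them.
  have heq : i + p = i' := by
    refine (ht.mono (by linarith [abs_nonneg p])).unique
      (hf.mono (L' := 14 * (r * M)) (by linarith)) ?_
    calc |i + p - i'| = |p - (i' - i)| := by ring_nf
      _ ≤ |p| + |i' - i| := abs_sub _ _
      _ ≤ _ := by linarith
  rw [← heq] at hi'
  simpa using hi'

/-- Two periods around a break are parallel. -/
theorem FirstBreak.parallel (hD : Spreads η r) (hr : 1 ≤ r) {a b i j p q p' q' : ℤ}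
    (h : FirstBreak η a b (16 * (r * M)) i j) (ha : |a| ≤ M) (hb : |b| ≤ M)
    (hp : |p| ≤ M) (hq : 0 ≤ q) (hqM : q ≤ M) (hp' : |p'| ≤ M) (hq' : 0 ≤ q') (hqM' : q' ≤ M)
    (hper : PeriodicNear η r p q i j (20 * (r * M)))
    (hper' : PeriodicNear η r p' q' i j (20 * (r * M))) : p * q' = p' * q := by
  have hM := (abs_nonneg a).trans ha
  have hMK : M ≤ r * M := le_mul_of_one_le_left hM hr
  have hb' : r * |b| ≤ r * M := by gcongr
  -- Since `q + q' ≤ 2 * M`, rows up to `2 * M` suffice; they lose at most `4 * (r * M)` of the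
  -- break's length. The value `0` beyond them is a dummy.
  have hrow : ∀ l : ℕ, ∃ i', (l : ℤ) ≤ 2 * M → |i' - i| ≤ 2 * (r * M) ∧
      FirstBreak η a b (12 * (r * M)) i' (j + l) := by
    intro l
    by_cases hl : (l : ℤ) ≤ 2 * M
    · obtain ⟨i', h1, h2⟩ := h.exists_row hD l
      have h3 : r * |(l : ℤ)| ≤ 2 * (r * M) := by
        rw [Nat.abs_cast, mul_left_comm]; gcongr
      exact ⟨i', fun _ => ⟨by linarith, h2.mono (by linarith)⟩⟩
    · exact ⟨0, fun h => absurd h hl⟩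
  choose β hβ using hrow
  have key : ∀ p q : ℤ, ∀ l m : ℕ, |p| ≤ M → (m : ℤ) ≤ M → (l : ℤ) ≤ M → (m : ℤ) = q →
      PeriodicNear η r p q i j (20 * (r * M)) → β (m + l) = β l + p := by
    intro p q l m hp hm hl hmq hper
    subst hmq
    obtain ⟨h1, h2⟩ := hβ l (by linarith)
    obtain ⟨h3, h4⟩ := hβ (m + l) (by push_cast; linarith)
    have h5 : r * |j + (l : ℤ) - j| ≤ r * M := by
      rw [add_sub_cancel_left, Nat.abs_cast]; gcongr
    have h6 := h2.translate_near (by linarith) ha hb' (by linarith) hper (by linarith)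
    have h7 : j + ((m + l : ℕ) : ℤ) = j + l + m := by push_cast; ring
    rw [h7] at h4
    refine h4.unique h6 ?_
    calc |β (m + l) - (β l + p)| = |(β (m + l) - i) - (β l - i) - p| := by ring_nf
      _ ≤ |(β (m + l) - i) - (β l - i)| + |p| := abs_sub _ _
      _ ≤ |β (m + l) - i| + |β l - i| + |p| := by gcongr; exact abs_sub _ _
      _ ≤ _ := by linarith
  lift q to ℕ using hq
  lift q' to ℕ using hq'
  -- Summing the break positions over `q + q'` rows, split after `q` or after `q'` rows, leaves `q'
  -- * p = q * p'`.
  have s1 := Finset.sum_range_add (fun l => β l) q q'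
  have s2 := Finset.sum_range_add (fun l => β l) q' q
  have t1 : ∑ l ∈ Finset.range q', β (q + l) = ∑ l ∈ Finset.range q', (β l + p) :=
    Finset.sum_congr rfl fun l hl => by
      have : (l : ℤ) < q' := by exact_mod_cast Finset.mem_range.1 hl
      exact key p q l q hp hqM (by linarith) rfl hper
  have t2 : ∑ l ∈ Finset.range q, β (q' + l) = ∑ l ∈ Finset.range q, (β l + p') :=
    Finset.sum_congr rfl fun l hl => by
      have : (l : ℤ) < q := by exact_mod_cast Finset.mem_range.1 hl
      exact key p' q' l q' hp' hqM' (by linarith) rfl hper'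
  rw [t1, Finset.sum_add_distrib, Finset.sum_const, Finset.card_range, nsmul_eq_mul] at s1
  rw [t2, Finset.sum_add_distrib, Finset.sum_const, Finset.card_range, nsmul_eq_mul,
    add_comm q' q] at s2
  linarith

/-! ### Extending a local period along a strip -/

theorem apply_add_mul_eq {p q k l : ℤ} (t : ℕ)
    (h : ∀ m : ℕ, m < t → η (k + m * p + p) (l + m * q + q) = η (k + m * p) (l + m * q)) :
    η (k + t * p) (l + t * q) = η k l := by
  induction t with
  | zero => simp
  | succ t ih =>
    rw [← ih fun m hm => h m (by omega), ← h t (by omega)]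
    congr 1 <;> push_cast <;> ring

/-- `(p, q)` is a period of `η` on the part of the strip of half-width `S` around the line through
`(i, j)` in direction `(p, q)` that lies at most `N` rows away from `(i, j)`. -/
def PeriodicOnStrip (η : ℤ → ℤ → A) (S p q i j N : ℤ) : Prop :=
  ∀ k l, |q * (k - i) - p * (l - j)| ≤ S * q → |l - j| ≤ N → η (k + p) (l + q) = η k l

theorem PeriodicOnStrip.apply_add_mul {S p q i j N k l : ℤ} (h : PeriodicOnStrip η S p q i j N)
    (hq : 0 < q) (hs : |q * (k - i) - p * (l - j)| ≤ S * q) (hl : |l - j| ≤ N) (t : ℤ)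
    (ht : |l + t * q - j| ≤ N) : η (k + t * p) (l + t * q) = η k l := by
  have key : ∀ (t : ℕ) (k l : ℤ), |q * (k - i) - p * (l - j)| ≤ S * q → |l - j| ≤ N →
      |l + t * q - j| ≤ N → η (k + t * p) (l + t * q) = η k l := by
    intro t k l hs hl ht
    refine apply_add_mul_eq t fun m hm => h _ _ ?_ ?_
    · convert hs using 2; ring
    · have h1 : (m : ℤ) * q ≤ t * q := by gcongr
      have h2 : 0 ≤ (m : ℤ) * q := by positivity
      rw [abs_le] at hl ht ⊢
      constructor <;> linarith
  obtain ⟨n, rfl | rfl⟩ := t.eq_nat_or_neg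
  · exact key n k l hs hl ht
  · have := key n (k + -n * p) (l + -n * q) (by convert hs using 2; ring) ht
      (by convert hl using 2; ring)
    rw [← this]
    congr 1 <;> ring

/-- Distance bound for a cell of a strip from a point of its axis. -/
theorem abs_sub_le_of_strip {S p q x y : ℤ} (hq : 0 < q) (hpq : |p| ≤ r * q)
    (h : |q * x - p * y| ≤ S * q) : |x| ≤ S + r * |y| := by
  have h1 : q * |x| ≤ q * (S + r * |y|) := by
    calc q * |x| = |(q * x - p * y) + p * y| := by rw [sub_add_cancel, abs_mul, abs_of_pos hq]
      _ ≤ |q * x - p * y| + |p| * |y| := by rw [← abs_mul]; exact abs_add_le _ _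
      _ ≤ S * q + r * q * |y| := by gcongr
      _ = _ := by ring
  exact le_of_mul_le_mul_left h1 hq

theorem strip_le_of_abs {S p q x y c : ℤ} (hq : 0 < q) (hpq : |p| ≤ r * q)
    (hx : |x| + r * |y| ≤ c) (hc : c ≤ S) : |q * x - p * y| ≤ S * q := by
  calc |q * x - p * y| ≤ |q * x| + |p * y| := abs_sub _ _
    _ = q * |x| + |p| * |y| := by rw [abs_mul, abs_mul, abs_of_pos hq]
    _ ≤ q * |x| + r * q * |y| := by gcongr
    _ = q * (|x| + r * |y|) := by ring
    _ ≤ q * S := by gcongr; linarith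
    _ = _ := mul_comm _ _

/-- A local period at a break with positive second coordinate. -/
theorem LocallyPeriodic.exists_at_break (hD : Spreads η r) (hr : 1 ≤ r) {R a b i j : ℤ}
    (hP : LocallyPeriodic η r M R) (hR : 20 * (r * M) ≤ R)
    (h : FirstBreak η a b (16 * (r * M)) i j) (ha : |a| ≤ M) (hb : |b| ≤ M) :
    ∃ p q, 0 < q ∧ q ≤ M ∧ |p| ≤ M ∧ |p| ≤ r * q ∧ PeriodicNear η r p q i j R := by
  obtain ⟨p, q, hne, hp, hq, hqM, hper⟩ := hP i j
  have hs := h.slope_le hD hr ha hb hp (by rwa [abs_of_nonneg hq]) (hper.mono hR)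
  rw [abs_of_nonneg hq] at hs
  refine ⟨p, q, hq.lt_of_ne' fun h0 => ?_, hqM, hp, hs, hper⟩
  subst h0
  simp at hs hne
  exact hne hs

/-- A small period around a break extends along a whole strip. -/
theorem FirstBreak.periodicOnStrip (hD : Spreads η r) (hr : 1 ≤ r) {a b i j p q : ℤ}
    (hP : LocallyPeriodic η r M (200 * (r * (r * M))))
    (h : FirstBreak η a b (16 * (r * M)) i j) (ha : |a| ≤ M) (hb : |b| ≤ M)
    (hq : 0 < q) (hqM : q ≤ M) (hp : |p| ≤ M) (hpq : |p| ≤ r * q)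
    (hper : PeriodicNear η r p q i j (200 * (r * (r * M)))) (N : ℤ) :
    PeriodicOnStrip η (40 * (r * M)) p q i j N := by
  have hM : 1 ≤ M := by linarith
  have hr0 : 0 ≤ r := by linarith
  have hMK : M ≤ r * M := le_mul_of_one_le_left (by linarith) hr
  have hKR : r * M ≤ r * (r * M) := le_mul_of_one_le_left (by linarith) hr
  have hb' : r * |b| ≤ r * M := by gcongr
  have hrM : r ≤ r * M := le_mul_of_one_le_right hr0 hM
  suffices H : ∀ n : ℕ, PeriodicOnStrip η (40 * (r * M)) p q i j (22 * (r * M) + n) by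
    obtain ⟨n, hn⟩ := Int.eq_ofNat_of_zero_le (abs_nonneg N)
    intro k l hs hl
    refine H n k l hs ?_
    rw [← hn]
    linarith [le_abs_self N]
  intro n
  induction n with
  | zero =>
    intro k l hs hl
    simp only [Nat.cast_zero, add_zero] at hl
    have h1 := abs_sub_le_of_strip hq hpq hs
    have h2 : r * |l - j| ≤ r * (22 * (r * M)) := by gcongr
    exact hper k l (by linarith)
  | succ n ih =>
    intro k l hs hl
    set N' := 22 * (r * M) + (n : ℤ) with hN'
    by_cases hl' : |l - j| ≤ N'
    · exact ih k l hs hl'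
    have hlN : |l - j| = N' + 1 := by
      push_cast at hl
      omega
    -- a translate of the break, slightly closer to the axis point than the row `l`
    obtain ⟨t, ht1, ht2⟩ : ∃ t : ℤ, |t * q| ≤ N' - 20 * (r * M) ∧
        |l - j - t * q| ≤ 22 * (r * M) := by
      -- Rounding down to a multiple of `q` costs less than `q ≤ M`, which the gap between `20` and
      -- `22` absorbs.
      set u := (N' - 20 * (r * M)) / q with hu
      have hu1 : u * q ≤ N' - 20 * (r * M) := Int.ediv_mul_le _ hq.ne'
      have hu2 : N' - 20 * (r * M) < u * q + q := by
        have := Int.lt_ediv_add_one_mul_self (N' - 20 * (r * M)) hq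
        linarith
      have hu0 : 0 ≤ u := Int.ediv_nonneg (by linarith) hq.le
      have hu3 : 0 ≤ u * q := by positivity
      rcases abs_choice (l - j) with hc | hc
      · refine ⟨u, by rwa [abs_of_nonneg hu3], abs_le.2 ⟨?_, ?_⟩⟩ <;> linarith
      · refine ⟨-u, by rw [neg_mul, abs_neg, abs_of_nonneg hu3]; exact hu1, abs_le.2 ⟨?_, ?_⟩⟩ <;>
          linarith
    have htb := abs_le.1 ht1
    have hbreak : FirstBreak η a b (16 * (r * M)) (i + t * p) (j + t * q) := by
      refine h.translate (fun m h1 h2 => ?_) (fun m h1 h2 => ?_) (by linarith)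
      · have h3 : |m - i| ≤ 16 * (r * M) := abs_le.2 ⟨by linarith, by linarith⟩
        refine ih.apply_add_mul hq ?_ (by simp only [sub_self, abs_zero]; linarith) t ?_
        · refine strip_le_of_abs hq hpq (c := 16 * (r * M)) ?_ (by linarith)
          simpa using h3
        · rw [add_sub_cancel_left]; linarith
      · have h3 : |m + a - i| ≤ 16 * (r * M) + M := by
          rw [add_sub_right_comm]
          refine (abs_add_le _ _).trans (add_le_add (abs_le.2 ⟨by linarith, by linarith⟩) ha)
        refine ih.apply_add_mul hq ?_ (by rw [add_sub_cancel_left]; linarith) t ?_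
        · refine strip_le_of_abs hq hpq (c := 18 * (r * M)) ?_ (by linarith)
          rw [add_sub_cancel_left]
          linarith
        · have : j + b + t * q - j = b + t * q := by ring
          rw [this]
          refine (abs_add_le _ _).trans ?_
          linarith
    obtain ⟨p', q', hq', hqM', hp', hpq', hper'⟩ :=
      hP.exists_at_break hD hr (by linarith) hbreak ha hb
    -- The margin of `20 * (r * M)` rows keeps this diamond inside the rows already treated, as
    -- `parallel` requires.
    have hnear : PeriodicNear η r p q (i + t * p) (j + t * q) (20 * (r * M)) := by
      intro m z hmz
      have h1 := abs_nonneg (m - (i + t * p))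
      have h2 : |z - (j + t * q)| ≤ r * |z - (j + t * q)| :=
        le_mul_of_one_le_left (abs_nonneg _) hr
      refine ih m z ?_ ?_
      · have : q * (m - i) - p * (z - j) = q * (m - (i + t * p)) - p * (z - (j + t * q)) := by
          ring
        rw [this]
        exact strip_le_of_abs hq hpq hmz (by linarith)
      · have : z - j = (z - (j + t * q)) + t * q := by ring
        rw [this]
        refine (abs_add_le _ _).trans ?_
        linarith
    have hpar : p * q' = p' * q := hbreak.parallel hD hr ha hb hp hq.le hqM hp' hq'.le hqM' hnear
      (hper'.mono (by linarith))
    have hx : |k - (i + t * p)| ≤ 40 * (r * M) + r * |l - (j + t * q)| := by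
      refine abs_sub_le_of_strip hq hpq ?_
      convert hs using 2
      ring
    have hy : |l - (j + t * q)| ≤ 22 * (r * M) := by convert ht2 using 2; ring
    -- both directions use the period `(p', q')` around the translated break
    have hnear' : ∀ x y, |x| ≤ 2 * M → |y| ≤ 2 * M →
        η (k + x + p') (l + y + q') = η (k + x) (l + y) := by
      intro x y hx' hy'
      refine hper' _ _ ?_
      have e1 : |k + x - (i + t * p)| ≤ |k - (i + t * p)| + |x| := by
        rw [add_sub_right_comm]; exact abs_add_le _ _
      have e2 : |l + y - (j + t * q)| ≤ |l - (j + t * q)| + |y| := by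
        rw [add_sub_right_comm]; exact abs_add_le _ _
      have e3 : r * |l + y - (j + t * q)| ≤ r * (24 * (r * M)) := by gcongr; linarith
      have e4 : r * |l - (j + t * q)| ≤ r * (22 * (r * M)) := by gcongr
      linarith
    have hp2 : |p| ≤ 2 * M := by linarith
    have hq2 : |q| ≤ 2 * M := by rw [abs_of_pos hq]; linarith
    -- Parallelism: moving by multiples of `(p', q')` does not leave the strip.
    have hlev : ∀ c : ℤ, |q * (k + c * p' - i) - p * (l + c * q' - j)| ≤ 40 * (r * M) * q := by
      intro c
      convert hs using 2
      linear_combination (-c) * hpar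
    -- One step of `(p', q')` towards row `j` reaches rows where `(p, q)` is known; the same step is
    -- undone at both cells being compared.
    rcases abs_choice (l - j) with hc | hc
    · have e1 := hnear' (-p') (-q') (by rw [abs_neg]; linarith)
        (by rw [abs_neg, abs_of_pos hq']; linarith)
      have e2 := hnear' (p - p') (q - q') ((abs_sub _ _).trans (by linarith))
        (by refine (abs_sub _ _).trans ?_; rw [abs_of_pos hq, abs_of_pos hq']; linarith)
      have e3 := ih (k + -p') (l + -q') (by simpa using hlev (-1))
        (abs_le.2 ⟨by linarith, by linarith⟩)
      have f1 : k + (p - p') + p' = k + p := by ring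
      have f2 : l + (q - q') + q' = l + q := by ring
      have f3 : k + (p - p') = k + -p' + p := by ring
      have f4 : l + (q - q') = l + -q' + q := by ring
      rw [f1, f2, f3, f4] at e2
      rw [neg_add_cancel_right, neg_add_cancel_right] at e1
      rw [e2, e3, e1]
    · have e1 := hnear' 0 0 (by simp; linarith) (by simp; linarith)
      have e2 := hnear' p q hp2 hq2
      have e3 := ih (k + p') (l + q') (by simpa using hlev 1)
        (abs_le.2 ⟨by linarith, by linarith⟩)
      rw [add_zero, add_zero] at e1
      rw [add_right_comm, add_right_comm l] at e2
      rw [← e2, e3, e1]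

/-! ### Sweeping from a strip to a half-plane -/

/-- A vector of the form `(p, q)`, `0 < q ≤ M`, parallel to `(p₀, q₀)`, is a period on the levels
`s, …, s + T` of the linear form `q₀ k - p₀ l`. -/
def PeriodicOnLevels (η : ℤ → ℤ → A) (M p₀ q₀ s T : ℤ) : Prop :=
  ∃ p q, 0 < q ∧ q ≤ M ∧ |p| ≤ M ∧ p * q₀ = p₀ * q ∧
    ∀ k l, s ≤ q₀ * k - p₀ * l → q₀ * k - p₀ * l ≤ s + T → η (k + p) (l + q) = η k l

theorem PeriodicOnStrip.levels {S p q i j p₀ q₀ k l : ℤ} (hq : 0 < q) (hq₀ : 0 < q₀)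
    (h : ∀ N, PeriodicOnStrip η S p q i j N) (hpar : p * q₀ = p₀ * q)
    (h1 : q₀ * i - p₀ * j - S * q₀ ≤ q₀ * k - p₀ * l)
    (h2 : q₀ * k - p₀ * l ≤ q₀ * i - p₀ * j + S * q₀) : η (k + p) (l + q) = η k l := by
  refine h _ k l ?_ le_rfl
  have h3 : |q₀ * (k - i) - p₀ * (l - j)| ≤ S * q₀ := abs_le.2 ⟨by linarith, by linarith⟩
  have h4 : q₀ * |q * (k - i) - p * (l - j)| ≤ q₀ * (S * q) := by
    calc q₀ * |q * (k - i) - p * (l - j)| = |q₀ * (q * (k - i) - p * (l - j))| := by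
          rw [abs_mul, abs_of_pos hq₀]
      _ = |q * (q₀ * (k - i) - p₀ * (l - j))| := by
          congr 1; linear_combination (-(l - j)) * hpar
      _ = q * |q₀ * (k - i) - p₀ * (l - j)| := by rw [abs_mul, abs_of_pos hq]
      _ ≤ q * (S * q₀) := by gcongr
      _ = _ := by ring
  exact le_of_mul_le_mul_left h4 hq₀

/-- Either the current period survives on the next level, or it breaks there and the strip around
that break supplies a new period. If the new one were not parallel to `(p₀, q₀)`, one of its two
signs would move the break back into the periodic levels. -/
theorem PeriodicOnLevels.succ (hD : Spreads η r) (hr : 1 ≤ r) {p₀ q₀ s : ℤ}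
    (hP : LocallyPeriodic η r M (200 * (r * (r * M)))) (hq₀ : 0 < q₀) (hpq₀ : |p₀| ≤ r * q₀)
    (h : PeriodicOnLevels η M p₀ q₀ s (40 * (r * M) * q₀)) :
    PeriodicOnLevels η M p₀ q₀ (s + 1) (40 * (r * M) * q₀) := by
  obtain ⟨p, q, hq, hqM, hp, hpar, hper⟩ := h
  by_cases hall : ∀ k l, q₀ * k - p₀ * l = s + 40 * (r * M) * q₀ + 1 →
      η (k + p) (l + q) = η k l
  · refine ⟨p, q, hq, hqM, hp, hpar, fun k l h1 h2 => ?_⟩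
    by_cases h3 : q₀ * k - p₀ * l = s + 40 * (r * M) * q₀ + 1
    · exact hall k l h3
    · exact hper k l (by linarith) (by omega)
  push Not at hall
  obtain ⟨i, j, hij, hne⟩ := hall
  have hM : 1 ≤ M := by linarith
  have hMK : M ≤ r * M := le_mul_of_one_le_left (by linarith) hr
  have hKR : r * M ≤ r * (r * M) := le_mul_of_one_le_left (by linarith) hr
  have hbreak : FirstBreak η p q (16 * (r * M)) i j := by
    refine ⟨hne, fun k h1 h2 => hper k j ?_ ?_⟩
    · have : q₀ * (i - 16 * (r * M)) ≤ q₀ * k := by gcongr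
      have : 0 ≤ (r * M) * q₀ := by positivity
      linarith
    · have : q₀ * (k + 1) ≤ q₀ * i := by gcongr; linarith
      linarith
  have hqM' : |q| ≤ M := by rwa [abs_of_pos hq]
  obtain ⟨p', q', hq', hqM'', hp', hpq', hper'⟩ :=
    hP.exists_at_break hD hr (by linarith) hbreak hp hqM'
  have hstrip := hbreak.periodicOnStrip hD hr hP hp hqM' hq' hqM'' hp' hpq' hper'
  have hpar' : p' * q₀ = p₀ * q' := by
    by_contra hne'
    have hδ : |q₀ * p' - p₀ * q'| ≤ 2 * (r * M) * q₀ := by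
      calc |q₀ * p' - p₀ * q'| ≤ |q₀ * p'| + |p₀ * q'| := abs_sub _ _
        _ = q₀ * |p'| + |p₀| * q' := by rw [abs_mul, abs_mul, abs_of_pos hq₀, abs_of_pos hq']
        _ ≤ q₀ * (r * M) + r * q₀ * M := by
            gcongr
            exact hp'.trans hMK
        _ = _ := by ring
    have hδ0 : q₀ * p' - p₀ * q' ≠ 0 := fun h0 => hne' (by linarith)
    have hx : 0 < r * M * q₀ := by positivity
    have hq1 : q ≤ r * M := by linarith
    -- the break translated by `± (p', q')` would lie in the periodic levels
    have hc := strip_le_of_abs (S := 40 * (r * M)) (x := 0) (y := 0) hq' hpq' (c := 0) (by simp)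
      (by linarith)
    have hc' : |q' * p - p' * q| ≤ 40 * (r * M) * q' := by
      refine strip_le_of_abs hq' hpq' (c := 2 * (r * M)) ?_ (by linarith)
      have : r * |q| ≤ r * M := by gcongr
      linarith
    have hshift : ∀ c : ℤ, η (i + c * p' + p) (j + c * q' + q) ≠
        η (i + c * p') (j + c * q') := by
      intro c
      have e1 := (hstrip (|c * q'| + |q + c * q'| + |q|)).apply_add_mul (k := i) (l := j) hq'
        (by simpa using hc) (by simp; positivity) c
        (by rw [add_sub_cancel_left]; linarith [abs_nonneg (q + c * q'), abs_nonneg q])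
      have e2 := (hstrip (|c * q'| + |q + c * q'| + |q|)).apply_add_mul (k := i + p) (l := j + q)
        hq' (by simpa using hc')
        (by rw [add_sub_cancel_left]; linarith [abs_nonneg (q + c * q'), abs_nonneg (c * q')]) c
        (by
          have : j + q + c * q' - j = q + c * q' := by ring
          rw [this]; linarith [abs_nonneg (c * q'), abs_nonneg q])
      rw [e1, add_right_comm, add_right_comm j, e2]
      exact hne
    rw [abs_le] at hδ
    rcases lt_or_gt_of_ne hδ0 with hneg | hpos
    · exact hshift 1 (hper _ _ (by linarith) (by linarith))
    · exact hshift (-1) (hper _ _ (by linarith) (by linarith))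
  refine ⟨p', q', hq', hqM'', hp', hpar', fun k l h1 h2 => ?_⟩
  exact PeriodicOnStrip.levels hq' hq₀ hstrip hpar' (by linarith) (by linarith)

/-- The period may change from level to level, but its direction is fixed and its height `q ≤ M`
divides `M!`, so one multiple serves all levels. -/
theorem PeriodicOnLevels.period_of_le (hD : Spreads η r) (hr : 1 ≤ r) {p₀ q₀ s : ℤ}
    (hP : LocallyPeriodic η r M (200 * (r * (r * M)))) (hq₀ : 0 < q₀) (hpq₀ : |p₀| ≤ r * q₀)
    (h : PeriodicOnLevels η M p₀ q₀ s (40 * (r * M) * q₀)) (hM : 0 ≤ M) {k l : ℤ}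
    (hkl : s ≤ q₀ * k - p₀ * l) :
    η (k + M.toNat.factorial * p₀) (l + M.toNat.factorial * q₀) = η k l := by
  have hn : ∀ n : ℕ, PeriodicOnLevels η M p₀ q₀ (s + n) (40 * (r * M) * q₀) := by
    intro n
    induction n with
    | zero => simpa using h
    | succ n ih =>
      have := ih.succ hD hr hP hq₀ hpq₀
      push_cast
      rwa [← add_assoc]
  obtain ⟨n, hn'⟩ := Int.eq_ofNat_of_zero_le (sub_nonneg.2 hkl)
  obtain ⟨p, q, hq, hqM, hp, hpar, hper⟩ := hn n
  lift q to ℕ using hq.le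
  lift q₀ to ℕ using hq₀.le
  have hdvd : q ∣ M.toNat.factorial :=
    Nat.dvd_factorial (by exact_mod_cast hq) (by omega)
  obtain ⟨c, hc⟩ := hdvd
  have hT : 0 ≤ 40 * (r * M) * (q₀ : ℤ) := by positivity
  have := apply_add_mul_eq (η := η) (p := p) (q := q) (k := k) (l := l) (c * q₀)
    (fun m _ => by
      have : (q₀ : ℤ) * (k + m * p) - p₀ * (l + m * q) = s + n := by
        linear_combination (m : ℤ) * hpar + hn'
      exact hper _ _ (by linarith) (by linarith))
  rw [← this, hc]
  congr 1
  · push_cast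
    linear_combination (-(c : ℤ)) * hpar
  · push_cast
    ring

/-! ### Reflection and the global period -/

theorem Spreads.mirror (hD : Spreads η r) : Spreads (fun i j => η (-i) j) r := by
  intro a b j e lo hi h i h1 h2
  have := hD (-a) b j e (-hi) (-lo) (fun i h1 h2 => by
    have := h (-i) (by linarith) (by linarith)
    simpa [add_comm] using this) (-i) (by linarith) (by linarith)
  simpa [add_comm] using this

theorem PeriodicNear.mirror {p q i j R : ℤ} (h : PeriodicNear η r p q i j R) :
    PeriodicNear (fun i j => η (-i) j) r (-p) q (-i) j R := by
  intro k l hkl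
  have := h (-k) l (by
    have : |-k - i| = |k - -i| := by rw [← abs_neg]; congr 1; ring
    rwa [this])
  simpa [add_comm] using this

theorem LocallyPeriodic.mirror {R : ℤ} (hP : LocallyPeriodic η r M R) :
    LocallyPeriodic (fun i j => η (-i) j) r M R := by
  intro i j
  obtain ⟨p, q, hne, hp, hq, hqM, hper⟩ := hP (-i) j
  refine ⟨-p, q, by simpa using hne, by rwa [abs_neg], hq, hqM, ?_⟩
  simpa using hper.mirror

/-- A configuration in which a small period breaks somewhere has a global period. -/
theorem FirstBreak.exists_period (hD : Spreads η r) (hr : 1 ≤ r) (hM : 0 ≤ M) {a b i j : ℤ}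
    (hP : LocallyPeriodic η r M (200 * (r * (r * M))))
    (h : FirstBreak η a b (16 * (r * M)) i j) (ha : |a| ≤ M) (hb : |b| ≤ M) :
    ∃ p q : ℤ, (p ≠ 0 ∨ q ≠ 0) ∧ ∀ k l, η (k + p) (l + q) = η k l := by
  have hKR : r * M ≤ r * (r * M) := le_mul_of_one_le_left (by positivity) hr
  have hK : 0 ≤ r * M := by positivity
  obtain ⟨p, q, hq, hqM, hp, hpq, hper⟩ := hP.exists_at_break hD hr (by linarith) h ha hb
  have hstrip := h.periodicOnStrip hD hr hP ha hb hq hqM hp hpq hper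
  have hT : 0 ≤ 40 * (r * M) * q := by positivity
  -- The strip starts both sweeps at the level of the break, so the two half-planes cover the plane.
  have hright : PeriodicOnLevels η M p q (q * i - p * j) (40 * (r * M) * q) :=
    ⟨p, q, hq, hqM, hp, rfl, fun k l h1 h2 =>
      PeriodicOnStrip.levels hq hq hstrip rfl (by linarith) (by linarith)⟩
  have hleft : PeriodicOnLevels (fun i j => η (-i) j) M (-p) q (-(q * i - p * j))
      (40 * (r * M) * q) := by
    refine ⟨-p, q, hq, hqM, by rwa [abs_neg], rfl, fun k l h1 h2 => ?_⟩
    have := PeriodicOnStrip.levels (k := -k) (l := l) hq hq hstrip rfl (by linarith) (by linarith)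
    simpa [add_comm] using this
  refine ⟨M.toNat.factorial * p, M.toNat.factorial * q, Or.inr ?_, fun k l => ?_⟩
  · have := M.toNat.factorial_pos
    positivity
  by_cases hkl : q * i - p * j ≤ q * k - p * l
  · exact hright.period_of_le hD hr hP hq hpq hM hkl
  · have := hleft.period_of_le hD.mirror hr hP.mirror hq (by rwa [abs_neg]) hM (k := -k) (l := l)
      (by linarith)
    simpa [add_comm] using this

/-- A configuration with horizontal determinism and small local periods has a global period. -/
theorem LocallyPeriodic.exists_period (hD : Spreads η r) (hr : 1 ≤ r) (hM : 0 ≤ M)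
    (hP : LocallyPeriodic η r M (200 * (r * (r * M)))) :
    ∃ p q : ℤ, (p ≠ 0 ∨ q ≠ 0) ∧ ∀ k l, η (k + p) (l + q) = η k l := by
  have hKR : r * M ≤ r * (r * M) := le_mul_of_one_le_left (by positivity) hr
  have hK : 0 ≤ r * M := by positivity
  have main : ∀ {η : ℤ → ℤ → A} {p q i : ℤ}, Spreads η r →
      LocallyPeriodic η r M (200 * (r * (r * M))) → |p| ≤ M → |q| ≤ M →
      PeriodicNear η r p q 0 0 (200 * (r * (r * M))) → 0 ≤ i → η (i + p) q ≠ η i 0 →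
      ∃ p q : ℤ, (p ≠ 0 ∨ q ≠ 0) ∧ ∀ k l, η (k + p) (l + q) = η k l := by
    intro η p q i hD hP hp hq hper hi hne
    -- Left of the least failure, the period holds by minimality on nonnegative cells and by the
    -- diamond at the origin on the negative ones needed.
    obtain ⟨m, ⟨hm0, hm⟩, hmin⟩ := Int.exists_least_of_bdd
      (P := fun k => 0 ≤ k ∧ η (k + p) q ≠ η k 0) ⟨0, fun z hz => hz.1⟩ ⟨i, hi, hne⟩
    refine FirstBreak.exists_period hD hr hM (a := p) (b := q) (i := m) (j := 0) hP
      ⟨by simpa using hm, fun k h1 h2 => ?_⟩ hp hq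
    by_cases hk : 0 ≤ k
    · by_contra hne
      have := hmin k ⟨hk, by simpa using hne⟩
      linarith
    · exact hper k 0 (by rw [sub_zero, sub_zero, abs_zero, abs_of_neg (by linarith)]; linarith)
  obtain ⟨p, q, hpq, hp, hq, hqM, hper⟩ := hP 0 0
  have hq' : |q| ≤ M := by rwa [abs_of_nonneg hq]
  by_cases hall : ∀ i, η (i + p) (0 + q) = η i 0
  · refine ⟨p, q, hpq, fun k l => ?_⟩
    exact PeriodicNear.of_row hD (i := 0) (R := |k| + r * |l|) (fun m _ => hall m) k l (by simp)
  push Not at hall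
  obtain ⟨i, hi⟩ := hall
  rw [zero_add] at hi
  rcases le_total 0 i with h0 | h0
  · exact main hD hP hp hq' hper h0 hi
  · have hperm := hper.mirror
    rw [neg_zero] at hperm
    obtain ⟨p', q', hne, h'⟩ := main hD.mirror hP.mirror (by rwa [abs_neg]) hq' hperm
      (i := -i) (by linarith) (by simpa [add_comm] using hi)
    refine ⟨-p', q', by simpa using hne, fun k l => ?_⟩
    simpa [add_comm] using h' (-k) l

end LatticeConfiguration

/-! ### Sliding block codes and space-time diagrams -/

namespace SubshiftAut

variable {A : Type*} [TopologicalSpace A] {X : Subshift A ℤ}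

theorem coe_vadd_apply (n : ℤ) (x : X.carrier) (i : ℤ) : (n +ᵥ x).1 i = x.1 (n + i) := rfl

theorem sigmaAut_zpow_apply (n : ℤ) (x : X.carrier) : (sigmaAut X ^ n).1 x = n +ᵥ x := by
  have hnat : ∀ (n : ℕ) (x : X.carrier), (sigmaAut X ^ n).1 x = (n : ℤ) +ᵥ x := by
    intro n
    induction n with
    | zero => intro x; simp
    | succ n ih =>
      intro x
      rw [pow_succ]
      change (sigmaAut X ^ n).1 ((1 : ℤ) +ᵥ x) = _
      rw [ih, vadd_vadd, Nat.cast_succ]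
  obtain ⟨m, rfl | rfl⟩ := n.eq_nat_or_neg
  · rw [zpow_natCast, hnat]
  · rw [zpow_neg, zpow_natCast]
    change (sigmaAut X ^ m).1.symm x = _
    rw [Homeomorph.symm_apply_eq, hnat, vadd_neg_vadd]

theorem Aut.map_vadd (φ : Aut X) (n : ℤ) (x : X.carrier) : φ.1 (n +ᵥ x) = n +ᵥ φ.1 x := by
  rw [← sigmaAut_zpow_apply, ← sigmaAut_zpow_apply]
  have h : Commute φ (sigmaAut X ^ n) := Commute.zpow_right (sigmaAut_comm X φ) n
  exact DFunLike.congr_fun (congrArg Subtype.val h.eq) x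

/-- The value of `φ x` at a cell depends only on the values of `x` at distance at most `r`. -/
def HasRange (φ : Aut X) (r : ℤ) : Prop :=
  ∀ (x y : X.carrier) (lo hi : ℤ), (∀ i, lo ≤ i → i ≤ hi → x.1 i = y.1 i) →
    ∀ i, lo + r ≤ i → i ≤ hi - r → (φ.1 x).1 i = (φ.1 y).1 i

theorem HasRange.mono {φ : Aut X} {r r' : ℤ} (h : HasRange φ r) (hr : r ≤ r') : HasRange φ r' :=
  fun x y lo hi hxy i h1 h2 => h x y lo hi hxy i (by linarith) (by linarith)

theorem HasRange.mul {φ ψ : Aut X} {r s : ℤ} (hφ : HasRange φ r) (hψ : HasRange ψ s) :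
    HasRange (φ * ψ) (r + s) := fun x y lo hi hxy i h1 h2 =>
  hφ (ψ.1 x) (ψ.1 y) (lo + s) (hi - s) (hψ x y lo hi hxy) i (by linarith) (by linarith)

theorem HasRange.one : HasRange (1 : Aut X) 0 :=
  fun _ _ _ _ hxy i h1 h2 => hxy i (by linarith) (by linarith)

theorem HasRange.pow {φ : Aut X} {r : ℤ} (h : HasRange φ r) (n : ℕ) :
    HasRange (φ ^ n) (r * n) := by
  induction n with
  | zero => simpa using HasRange.one
  | succ n ih =>
    rw [pow_succ, Nat.cast_succ, mul_add, mul_one]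
    exact ih.mul h

theorem HasRange.zpow {φ : Aut X} {r : ℤ} (h : HasRange φ r) (h' : HasRange φ⁻¹ r) (n : ℤ) :
    HasRange (φ ^ n) (r * |n|) := by
  obtain ⟨m, rfl | rfl⟩ := n.eq_nat_or_neg
  · simpa using h.pow m
  · simpa using h'.pow m

theorem compactSpace_carrier [Finite A] (X : Subshift A ℤ) : CompactSpace X.carrier :=
  isCompact_iff_compactSpace.1 X.isClosed.isCompact

/-- Curtis–Hedlund–Lyndon: an automorphism of a subshift is a sliding block code. -/
theorem exists_hasRange [Finite A] [DiscreteTopology A] (φ : Aut X) :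
    ∃ r : ℕ, HasRange φ r := by
  have := compactSpace_carrier X
  have hcoord : ∀ i : ℤ, Continuous fun x : X.carrier => x.1 i :=
    fun i => (continuous_apply i).comp continuous_subtype_val
  -- Decreasing closed sets of counterexamples; by compactness, if none were empty, they would share
  -- a pair `(y, y)` with differing images.
  let B : ℕ → Set (X.carrier × X.carrier) := fun n =>
    {z | (∀ i : ℤ, |i| ≤ n → z.1.1 i = z.2.1 i) ∧ (φ.1 z.1).1 0 ≠ (φ.1 z.2).1 0}
  have hclosed : ∀ n, IsClosed (B n) := by
    intro n
    have h1 : IsClosed {z : X.carrier × X.carrier | ∀ i : ℤ, |i| ≤ n → z.1.1 i = z.2.1 i} := by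
      simp only [Set.ofPred_forall]
      exact isClosed_iInter fun i => isClosed_iInter fun _ =>
        isClosed_eq ((hcoord i).comp continuous_fst) ((hcoord i).comp continuous_snd)
    have h2 : IsClosed {z : X.carrier × X.carrier | (φ.1 z.1).1 0 ≠ (φ.1 z.2).1 0} :=
      (isClosed_discrete {w : A × A | w.1 ≠ w.2}).preimage
        ((((hcoord 0).comp φ.1.continuous).comp continuous_fst).prodMk
          (((hcoord 0).comp φ.1.continuous).comp continuous_snd))
    exact h1.inter h2
  have hex : ∃ n, B n = ∅ := by
    by_contra! hno
    obtain ⟨z, hz⟩ := IsCompact.nonempty_iInter_of_directed_nonempty_isCompact_isClosed B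
      (directed_of_isDirected_le fun m n hmn z hz =>
        ⟨fun i hi => hz.1 i (hi.trans (by exact_mod_cast hmn)), hz.2⟩)
      hno (fun n => (hclosed n).isCompact) hclosed
    rw [Set.mem_iInter] at hz
    refine (hz 0).2 ?_
    have : z.1 = z.2 := Subtype.ext (funext fun i =>
      (hz i.natAbs).1 i (by rw [Int.natCast_natAbs]))
    rw [this]
  obtain ⟨n, hn⟩ := hex
  refine ⟨n, fun x y lo hi hxy i h1 h2 => ?_⟩
  by_contra hne
  refine Set.notMem_empty (i +ᵥ x, i +ᵥ y) (hn ▸ ⟨fun k hk => ?_, ?_⟩)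
  · rw [abs_le] at hk
    exact hxy (i + k) (by linarith) (by linarith)
  · simpa only [Aut.map_vadd, coe_vadd_apply, add_zero] using hne

/-- The space-time diagram of `φ` with initial row `x`. -/
def spacetime (φ : Aut X) (x : X.carrier) (i j : ℤ) : A := ((φ ^ j).1 x).1 i

theorem spreads_spacetime {φ : Aut X} {r : ℤ} (h : HasRange φ r) (h' : HasRange φ⁻¹ r)
    (x : X.carrier) : LatticeConfiguration.Spreads (spacetime φ x) r := by
  intro a b j e lo hi hyp i h1 h2
  have hcomp : ∀ m n : ℤ, (φ ^ n).1 ((φ ^ m).1 x) = (φ ^ (n + m)).1 x := fun m n => by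
    rw [zpow_add]; rfl
  have := h.zpow h' e (a +ᵥ (φ ^ (j + b)).1 x) ((φ ^ j).1 x) lo hi
    (fun k h3 h4 => by rw [coe_vadd_apply, add_comm a k]; exact hyp k h3 h4) i h1 h2
  rw [Aut.map_vadd, coe_vadd_apply, hcomp, hcomp] at this
  unfold spacetime
  rw [add_comm i a, add_comm j e, add_assoc e j b]
  exact this

/-- If there are fewer than `M²` words of a length `n ≫ M`, then every space-time diagram has
small local periods. -/
theorem locallyPeriodic_spacetime [Finite A] {φ : Aut X} {r : ℤ} (hr : 0 ≤ r) (h : HasRange φ r)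
    (h' : HasRange φ⁻¹ r) (x : X.carrier) {n M : ℕ} {R : ℤ}
    (hn : 2 * (R + M + r * M) + 1 ≤ n) (hcard : blockComplexity X n < M * M) :
    LatticeConfiguration.LocallyPeriodic (spacetime φ x) r M R := by
  intro i j
  -- A window is off centre by less than `M` cells and `M` rows; this half-width still controls the
  -- diamond of radius `R` around `(i, j)`.
  set S := R + M + r * M with hS
  let f : Fin M × Fin M → Fin n → A := fun z t => spacetime φ x (i + z.1 - S + t) (j + z.2)
  obtain ⟨z, -, z', -, hne, hf⟩ := Set.exists_ne_map_eq_of_ncard_lt_of_maps_to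
    (s := (Set.univ : Set (Fin M × Fin M))) (t := {β : Fin n → A |
      ({x : ℤ → A | ∀ i : Fin n, x ((i : ℕ) : ℤ) = β i} ∩ X.carrier).Nonempty})
    (by rw [Set.ncard_univ, Nat.card_prod, Nat.card_fin]; exact hcard) (f := f)
    (fun z _ => ⟨((i + z.1 - S) +ᵥ (φ ^ (j + (z.2 : ℤ))).1 x).1, fun t => rfl,
      ((i + z.1 - S) +ᵥ (φ ^ (j + (z.2 : ℤ))).1 x).2⟩) (Set.toFinite _)
  have main : ∀ z z' : Fin M × Fin M, z ≠ z' → f z = f z' → z.2 ≤ z'.2 →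
      ∃ p q : ℤ, (p ≠ 0 ∨ q ≠ 0) ∧ |p| ≤ M ∧ 0 ≤ q ∧ q ≤ M ∧
        LatticeConfiguration.PeriodicNear (spacetime φ x) r p q i j R := by
    rintro ⟨u, v⟩ ⟨u', v'⟩ hne hf hle
    have hu := u.2
    have hu' := u'.2
    have hv := v.2
    have hv' := v'.2
    have hle' : (v : ℕ) ≤ v' := hle
    refine ⟨(u' : ℤ) - u, (v' : ℤ) - v, ?_, abs_le.2 ⟨by omega, by omega⟩, by omega, by omega, ?_⟩
    · by_contra! h0
      exact hne (Prod.ext (Fin.ext (by simp; omega)) (Fin.ext (by simp; omega)))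
    have hrow : LatticeConfiguration.PeriodicNear (spacetime φ x) r ((u' : ℤ) - u) ((v' : ℤ) - v)
        (i + u) (j + v) S := by
      refine LatticeConfiguration.PeriodicNear.of_row (spreads_spacetime h h' x) fun k hk => ?_
      rw [abs_le] at hk
      have := congrFun hf ⟨(k - (i + u) + S).toNat, by omega⟩
      simp only [f] at this
      rw [Int.toNat_of_nonneg (by omega)] at this
      convert this.symm using 2 <;> ring
    intro k l hkl
    refine hrow k l ?_
    have e1 : |k - (i + u)| ≤ |k - i| + M := by
      rw [← sub_sub]
      refine (abs_sub _ _).trans ?_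
      rw [Nat.abs_cast]
      gcongr
    have e2 : |l - (j + v)| ≤ |l - j| + M := by
      rw [← sub_sub]
      refine (abs_sub _ _).trans ?_
      rw [Nat.abs_cast]
      gcongr
    have e3 := mul_le_mul_of_nonneg_left e2 hr
    linarith
  rcases le_total z.2 z'.2 with hle | hle
  · exact main z z' hne hf hle
  · exact main z' z hne.symm hf.symm hle

/-- With `M = n / C` and `n ≥ C` one has `n ≤ 2 * C * M`, so `P_X(n) < n² / (2C)²` is enough. -/
theorem SubquadraticGrowth.exists_blockComplexity_lt (h : SubquadraticGrowth X) {C : ℕ}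
    (hC : 0 < C) : ∃ n M : ℕ, C * M ≤ n ∧ blockComplexity X n < M * M := by
  have hD : (0 : ℝ≥0∞) < (((2 * C) ^ 2 : ℕ) : ℝ≥0∞)⁻¹ :=
    ENNReal.inv_pos.2 (ENNReal.natCast_ne_top _)
  have hlt := hD
  rw [← h] at hlt
  obtain ⟨n, hn, hnC⟩ := ((frequently_lt_of_liminf_lt (by isBoundedDefault) hlt).and_eventually
    (eventually_ge_atTop C)).exists
  refine ⟨n, n / C, Nat.mul_div_le n C, ?_⟩
  have hn0 : (n : ℝ≥0∞) ≠ 0 := by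
    have : n ≠ 0 := by omega
    exact_mod_cast this
  rw [ENNReal.div_lt_iff (Or.inl (by simpa using hn0)) (Or.inl (by finiteness)), mul_comm,
    ← div_eq_mul_inv, ENNReal.lt_div_iff_mul_lt (Or.inl (by simpa using hC.ne'))
    (Or.inl (ENNReal.natCast_ne_top _))] at hn
  have hn' : blockComplexity X n * (2 * C) ^ 2 < n ^ 2 := by exact_mod_cast hn
  have h1 : 1 ≤ n / C := (Nat.one_le_div_iff hC).2 hnC
  have h2 : n ≤ 2 * C * (n / C) := by
    have := Nat.div_add_mod n C
    have := Nat.mod_lt n hC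
    nlinarith
  have h3 : n ^ 2 ≤ (2 * C * (n / C)) ^ 2 := by gcongr
  have h4 : blockComplexity X n * (2 * C) ^ 2 < (n / C * (n / C)) * (2 * C) ^ 2 := by
    calc _ < n ^ 2 := hn'
      _ ≤ _ := h3
      _ = _ := by ring
  exact lt_of_mul_lt_mul_right h4 (by positivity)

/-! ### From pointwise relations to a relation in `Aut(X)` -/

theorem exists_vadd_zpow_eq [Finite A] [DiscreteTopology A] (hgrowth : SubquadraticGrowth X)
    (φ : Aut X) (x : X.carrier) :
    ∃ p q : ℤ, (p ≠ 0 ∨ q ≠ 0) ∧ p +ᵥ (φ ^ q).1 x = x := by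
  obtain ⟨r₁, h₁⟩ := exists_hasRange φ
  obtain ⟨r₂, h₂⟩ := exists_hasRange φ⁻¹
  set r := r₁ + r₂ + 1 with hr
  have h₁' : HasRange φ (r : ℤ) := h₁.mono (by push_cast [hr]; linarith)
  have h₂' : HasRange φ⁻¹ (r : ℤ) := h₂.mono (by push_cast [hr]; linarith)
  -- `405 = 2 * (200 + 1 + 1) + 1` bounds the window length for `R = 200 * (r * (r * M))`, as `r, M
  -- ≥ 1`.
  obtain ⟨n, M, hn, hcard⟩ := hgrowth.exists_blockComplexity_lt (C := 405 * (r * r))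
    (by positivity)
  have hM : 1 ≤ M := by
    by_contra h0
    have : M = 0 := by omega
    simp [this] at hcard
  have hr1 : (1 : ℤ) ≤ r := by push_cast [hr]; linarith
  have hM1 : (1 : ℤ) ≤ M := by exact_mod_cast hM
  have e1 : (M : ℤ) ≤ r * M := le_mul_of_one_le_left (by linarith) hr1
  have e2 : (r : ℤ) * M ≤ r * (r * M) := le_mul_of_one_le_left (by linarith) hr1
  have e3 : (405 : ℤ) * (r * r) * M ≤ n := by exact_mod_cast hn
  have hP := locallyPeriodic_spacetime (by linarith) h₁' h₂' x
    (R := 200 * ((r : ℤ) * (r * M))) (by linarith) hcard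
  obtain ⟨p, q, hpq, hper⟩ := hP.exists_period (spreads_spacetime h₁' h₂' x) hr1 (by linarith)
  refine ⟨p, q, hpq, Subtype.ext (funext fun k => ?_)⟩
  have := hper k 0
  rw [zero_add, add_comm] at this
  rw [coe_vadd_apply]
  simpa [spacetime] using this

theorem exists_zpow_mul_zpow_eq_one [Finite A] [DiscreteTopology A]
    (htrans : AddAction.IsTopologicallyTransitive ℤ X.carrier)
    (hgrowth : SubquadraticGrowth X) (φ : Aut X) :
    ∃ p q : ℤ, (p ≠ 0 ∨ q ≠ 0) ∧ sigmaAut X ^ p * φ ^ q = 1 := by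
  have := compactSpace_carrier X
  rcases isEmpty_or_nonempty X.carrier with hX | hX
  · exact ⟨1, 0, Or.inl one_ne_zero, Subtype.ext (Homeomorph.ext fun x => hX.elim x)⟩
  let F : {z : ℤ × ℤ // z.1 ≠ 0 ∨ z.2 ≠ 0} → Set X.carrier :=
    fun z => {x | (sigmaAut X ^ z.1.1 * φ ^ z.1.2).1 x = x}
  have hF : ∀ z, IsClosed (F z) := fun z =>
    isClosed_eq (sigmaAut X ^ z.1.1 * φ ^ z.1.2).1.continuous continuous_id
  have hU : ⋃ z, F z = Set.univ := by
    refine Set.eq_univ_of_forall fun x => Set.mem_iUnion.2 ?_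
    obtain ⟨p, q, hpq, hx⟩ := exists_vadd_zpow_eq hgrowth φ x
    refine ⟨⟨(p, q), hpq⟩, ?_⟩
    change (sigmaAut X ^ p).1 ((φ ^ q).1 x) = x
    rw [sigmaAut_zpow_apply, hx]
  obtain ⟨z, hz⟩ := nonempty_interior_of_iUnion_of_closed hF hU
  -- The set is shift-invariant because automorphisms commute with `σ`; by transitivity the
  -- translates of its interior are dense.
  have hdense : Dense (F z) := by
    refine (isOpen_interior.dense_iUnion_preimage_vadd ℤ hz).mono
      (Set.iUnion_subset fun m x hx => ?_)
    have hmx : (sigmaAut X ^ z.1.1 * φ ^ z.1.2).1 (m +ᵥ x) = m +ᵥ x :=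
      interior_subset (s := F z) hx
    rw [Aut.map_vadd] at hmx
    exact vadd_left_cancel m hmx
  refine ⟨z.1.1, z.1.2, z.2, Subtype.ext (Homeomorph.ext fun x => ?_)⟩
  have : x ∈ F z := by
    rw [← (hF z).closure_eq, hdense.closure_eq]
    trivial
  exact this

theorem finite_carrier_of_periodic [Finite A] {p : ℤ} (hp : p ≠ 0)
    (h : ∀ x : X.carrier, p +ᵥ x = x) : Finite X.carrier := by
  refine Finite.of_injective (fun (x : X.carrier) (i : Set.Ico (0 : ℤ) |p|) => x.1 i) ?_
  intro x y hxy
  have hper : ∀ x : X.carrier, Function.Periodic x.1 p := fun x i => by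
    rw [add_comm, ← coe_vadd_apply, h]
  have hmod : ∀ (x : X.carrier) (i : ℤ), x.1 i = x.1 (i % p) := fun x i => by
    rw [Int.emod_def, mul_comm, ← smul_eq_mul, (hper x).sub_zsmul_eq]
  refine Subtype.ext (funext fun i => ?_)
  rw [hmod x, hmod y]
  exact congrFun hxy ⟨i % p, Int.emod_nonneg _ hp, Int.emod_lt_abs _ hp⟩

end SubshiftAut

theorem theorem1 {A : Type*} [Finite A] [TopologicalSpace A] [DiscreteTopology A]
    (X : SymbolicDynamics.FullShift.Subshift A ℤ)
    (htrans : AddAction.IsTopologicallyTransitive ℤ X.carrier)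
    (hgrowth : SubshiftAut.SubquadraticGrowth X) :
    IsMulTorsion (SubshiftAut.Aut X ⧸ SubshiftAut.shiftSubgroup X) := by
  intro g
  obtain ⟨φ, rfl⟩ := QuotientGroup.mk_surjective g
  obtain ⟨p, q, hpq, h⟩ := SubshiftAut.exists_zpow_mul_zpow_eq_one htrans hgrowth φ
  by_cases hq : q = 0
  · subst hq
    rw [zpow_zero, mul_one] at h
    have := SubshiftAut.finite_carrier_of_periodic (X := X) (p := p) (by simpa using hpq)
      fun x => by rw [← SubshiftAut.sigmaAut_zpow_apply, h]; rfl
    have : Finite (X.carrier ≃ₜ X.carrier) :=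
      Finite.of_injective (fun f : X.carrier ≃ₜ X.carrier => (f : X.carrier → X.carrier))
        DFunLike.coe_injective
    exact (QuotientGroup.mk' (SubshiftAut.shiftSubgroup X)).isOfFinOrder (isOfFinOrder_of_finite φ)
  · refine isOfFinOrder_iff_zpow_eq_one.2 ⟨q, hq, ?_⟩
    rw [← QuotientGroup.mk_zpow, QuotientGroup.eq_one_iff, eq_inv_of_mul_eq_one_right h]
    have hσ : SubshiftAut.sigmaAut X ∈ SubshiftAut.shiftSubgroup X :=
      Subgroup.subset_closure (Set.mem_singleton _)
    exact Subgroup.inv_mem _ (Subgroup.zpow_mem _ hσ p)
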